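/- **Theorem (Arbitrary distillation of quantum learnability).** Let $\mathcal H$ be a finite-dimensional Hilbert space, $M\ge 1$, let $A_1,\dots,A_M$ be Hermitian operators on $\mathcal H$, $|\psi_0\rangle$ a unit vector, and for $\theta\in\mathbb R^M$ put $U(\theta)=e^{i\theta_M A_M}\cdots e^{i\theta_1A_1}$, $|\psi_\theta\rangle=U(\theta)|\psi_0\rangle$, $\rho_\theta=|\psi_\theta\rangle\langle\psi_\theta|$. For a family of pure states, the (symmetric-logarithmic-derivative) quantum Fisher information matrix (QFIM) is $$\mathcal I_{i,j}(\theta|\psi_\theta)=4\,\mathrm{Re}\left[\langle\partial_i\psi_\theta|\partial_j\psi_\theta\rangle-\langle\partial_i\psi_\theta|\psi_\theta\rangle\langle\psi_\theta|\partial_j\psi_\theta\rangle\right].$$ For a positive semidefinite real weight matrix $W$ and a number $N\ge1$ of trials let $$s^{(\mathrm{MI})}(\psi_\theta,W)=\frac1N\inf_{\mathcal M}\mathrm{Tr}\left[W I^{-1}(\theta)\right],$$ where $\mathcal M$ runs over all measurements (POVMs) with finitely many outcomes and $I(\theta)$ is the classical Fisher information matrix of the outcome distribution $p(k|\theta)$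 of $\mathcal M$ in the state $\psi_\theta$ (the trace is read as $+\infty$ if $I(\theta)$ is singular). Fix the true value $\theta$. For an initial estimate $\theta^0\in\mathbb R^M$ put $\delta=\max_m|\theta_m-\theta^0_m|$ and, for $0\le t\le1$, let $K=(t-1)\rho_{\theta^0}+1$ and $F=K^\dagger K$, let $p^{\mathrm{ps}}=\mathrm{Tr}(F\rho_\theta)$ be the success probability, and let $|\psi^{\mathrm{ps}}_\theta\rangle=K|\psi_\theta\rangle/\sqrt{p^{\mathrm{ps}}}$ be the distilled state ($\theta^0$ and $K$ are held fixed when differentiating in $\theta$). Then $0\le F\le 1$, so $\{F,1-F\}$ is a measurement, and: 1. There is a constant $C$, independent of $t$ and $\theta^0$, such that $|p^{\mathrm{ps}}-t^2|\le C\delta^2$ for all $0\le t\le 1$; and for all $0<t\le1$ and all $i,j$, $p^{\mathrm{ps}}>0$, $$\left|\mathcal I_{i,j}(\theta|\psi^{\mathrm{ps}}_\theta)-\frac{\mathcal I_{i,j}(\theta|\psi_\theta)}{t^2}\right|\le \frac{C\delta^2}{t^4},\qquad \left|p^{\mathrm{ps}}\,\mathcal I_{i,j}(\theta|\psi^{\mathrm{ps}}_\theta)-\mathcal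 I_{i,j}(\theta|\psi_\theta)\right|\le\frac{C\delta^2}{t^2}.$$ In particular, for each fixed $t\in(0,1]$, $\mathcal I(\theta|\psi^{\mathrm{ps}}_\theta)=\mathcal I(\theta|\psi_\theta)/t^2+O(\delta^2)$, $p^{\mathrm{ps}}=t^2+O(\delta^2)$, and the distillation is lossless: $p^{\mathrm{ps}}\,\mathcal I(\theta|\psi^{\mathrm{ps}}_\theta)=\mathcal I(\theta|\psi_\theta)+O(\delta^2)$. 2. Let $t\to0^+$ and let $\theta^0$ vary with $t$ such that $M\delta^2/t^2\to0$. Then $p^{\mathrm{ps}}\,\mathcal I(\theta|\psi^{\mathrm{ps}}_\theta)\to\mathcal I(\theta|\psi_\theta)$, and $|\mathcal I_{i,j}(\theta|\psi^{\mathrm{ps}}_\theta)|\to\infty$ whenever $\mathcal I_{i,j}(\theta|\psi_\theta)\ne0$. If $\mathcal I(\theta|\psi_\theta)$ is nonsingular, then moreover $\mathcal I(\theta|\psi^{\mathrm{ps}}_\theta)\to\infty$, that is, for every real $B$ eventually $\mathcal I(\theta|\psi^{\mathrm{ps}}_\theta)\ge B\cdot 1$ as a matrix inequality, and $\det\mathcal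 I(\theta|\psi^{\mathrm{ps}}_\theta)\to\infty$; and $s^{(\mathrm{MI})}(\psi^{\mathrm{ps}}_\theta,W)\to0$ for all $N\ge 1$ and all positive semidefinite $W$. -/

import Mathlib

open Filter Topology
open scoped ENNReal

noncomputable section

namespace QLearn

variable {H : Type*} [NormedAddCommGroup H] [InnerProductSpace ℂ H] [CompleteSpace H] {M : ℕ}

/-- The partial derivative `∂ᵢ f` at `θ`. -/
def partialDeriv {E : Type*} [NormedAddCommGroup E] [NormedSpace ℝ E]
    (i : Fin M) (f : (Fin M → ℝ) → E) (θ : Fin M → ℝ) : E :=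
  deriv (fun s : ℝ => f (Function.update θ i s)) (θ i)

/-- The unitary `U(θ) = U_M(θ_M) ⋯ U_1(θ_1)` with `U_m(θ_m) = exp(i θ_m A_m)`. The factor with the
smallest index acts first. -/
def encU (A : Fin M → H →L[ℂ] H) (θ : Fin M → ℝ) : H →L[ℂ] H :=
  (List.ofFn fun m => NormedSpace.exp ((Complex.I * (θ m : ℂ)) • A m)).reverse.prod

/-- The encoded state vector `|ψ_θ⟩ = U(θ)|ψ₀⟩`. -/
def encState (A : Fin M → H →L[ℂ] H) (ψ₀ : H) (θ : Fin M → ℝ) : H := encU A θ ψ₀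

/-- The encoded density operator `ρ_θ = U(θ) ρ₀ U(θ)†`, with `ρ₀ = |ψ₀⟩⟨ψ₀|`. -/
def encRho (A : Fin M → H →L[ℂ] H) (ψ₀ : H) (θ : Fin M → ℝ) : H →L[ℂ] H :=
  encU A θ * InnerProductSpace.rankOne ℂ ψ₀ ψ₀ * ContinuousLinearMap.adjoint (encU A θ)

/-- The quantum Fisher information matrix (symmetric logarithmic derivative) of a family of
normalized pure states `θ ↦ |ψ_θ⟩`:
`4 Re [⟨∂ᵢψ|∂ⱼψ⟩ - ⟨∂ᵢψ|ψ⟩⟨ψ|∂ⱼψ⟩]`. -/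
def qfim (ψ : (Fin M → ℝ) → H) (θ : Fin M → ℝ) : Matrix (Fin M) (Fin M) ℝ :=
  Matrix.of fun i j =>
    4 * (inner ℂ (partialDeriv i ψ θ) (partialDeriv j ψ θ)
      - inner ℂ (partialDeriv i ψ θ) (ψ θ) * inner ℂ (ψ θ) (partialDeriv j ψ θ)).re

/-- The postselection operator `F = K†K` of a Kraus operator `K`. -/
def postF (K : H →L[ℂ] H) : H →L[ℂ] H := ContinuousLinearMap.adjoint K * K

/-- The success probability `Tr(F ρ_θ)` of the postselection. -/
def postProb (K : H →L[ℂ] H) (A : Fin M → H →L[ℂ] H) (ψ₀ : H) (θ : Fin M → ℝ) : ℝ :=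
  (LinearMap.trace ℂ H (postF K * encRho A ψ₀ θ : H →L[ℂ] H)).re

/-- The postselected (distilled) state vector `K|ψ_θ⟩ / √(p_θ)`. -/
def postState (K : H →L[ℂ] H) (A : Fin M → H →L[ℂ] H) (ψ₀ : H) (θ : Fin M → ℝ) : H :=
  (((Real.sqrt (postProb K A ψ₀ θ))⁻¹ : ℝ) : ℂ) • K (encState A ψ₀ θ)

/-- The distilling Kraus operator `K = (t - 1) ρ_{θ⁰} + 1`. -/
def distK (A : Fin M → H →L[ℂ] H) (ψ₀ : H) (θ₀ : Fin M → ℝ) (t : ℝ) : H →L[ℂ] H :=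
  ((t - 1 : ℝ) : ℂ) • encRho A ψ₀ θ₀ + 1

/-- The success probability, at the true parameter `θ`, of the distillation built from the
estimate `θ₀`. -/
def distProb (A : Fin M → H →L[ℂ] H) (ψ₀ : H) (θ₀ : Fin M → ℝ) (t : ℝ) (θ : Fin M → ℝ) : ℝ :=
  postProb (distK A ψ₀ θ₀ t) A ψ₀ θ

/-- The family of distilled states; the estimate `θ₀`, hence `K`, does not vary with `θ`. -/
def distState (A : Fin M → H →L[ℂ] H) (ψ₀ : H) (θ₀ : Fin M → ℝ) (t : ℝ) (θ : Fin M → ℝ) : H :=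
  postState (distK A ψ₀ θ₀ t) A ψ₀ θ

/-- A quantum measurement (POVM) with `n` outcomes on `H`. -/
structure Measurement (H : Type*) [NormedAddCommGroup H] [InnerProductSpace ℂ H]
    [CompleteSpace H] (n : ℕ) where
  /-- the effects -/
  effect : Fin n → H →L[ℂ] H
  isPositive : ∀ k, (effect k).IsPositive
  sum_eq_one : ∑ k, effect k = 1

/-- Born's rule: the probability `p(k|θ) = ⟨ψ_θ|E_k|ψ_θ⟩`. -/
def outcomeProb {n : ℕ} (E : Measurement H n) (ψ : (Fin M → ℝ) → H) (k : Fin n)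
    (θ : Fin M → ℝ) : ℝ :=
  (inner ℂ (ψ θ) (E.effect k (ψ θ))).re

/-- The classical Fisher information matrix of the outcomes of `E`:
`∑ₖ p(k|θ) (∂ᵢ log p(k|θ)) (∂ⱼ log p(k|θ))`. Outcomes of probability zero contribute zero. -/
def fisher {n : ℕ} (E : Measurement H n) (ψ : (Fin M → ℝ) → H) (θ : Fin M → ℝ) :
    Matrix (Fin M) (Fin M) ℝ :=
  Matrix.of fun i j => ∑ k, outcomeProb E ψ k θ
    * partialDeriv i (fun η => Real.log (outcomeProb E ψ k η)) θ
    * partialDeriv j (fun η => Real.log (outcomeProb E ψ k η)) θ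

open Classical in
/-- The scalar risk `Tr(W I⁻¹) / N` of a Fisher information matrix `I`, after `N` trials; it is
infinite if `I` is singular. -/
def scalarRisk (N : ℕ) (I W : Matrix (Fin M) (Fin M) ℝ) : ℝ≥0∞ :=
  if I.det = 0 then ⊤ else ENNReal.ofReal ((W * I⁻¹).trace / N)

/-- The scalar risk of the most informative measurement, optimized over all measurements with
finitely many outcomes. -/
def riskMI (N : ℕ) (ψ : (Fin M → ℝ) → H) (θ : Fin M → ℝ) (W : Matrix (Fin M) (Fin M) ℝ) : ℝ≥0∞ :=
  ⨅ (n : ℕ) (E : Measurement H n), scalarRisk N (fisher E ψ θ) W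

end QLearn

end

/-!
The distilling operator `K` multiplies by `t` on the line through `φ = ψ_{θ⁰}` and is the identity
on the orthogonal complement. The QFIM is four times the real part of the Gram matrix of the
horizontal derivatives, the components of `∂ᵢψ` orthogonal to `ψ_θ`. These are orthogonal to `φ` up
to `O(δ)`, so `K` preserves their inner products up to `O(δ²)`, while the squared norm of `ψ_θ`
drops from `1` to `p = t² + O(δ²)`. Normalizing the state divides the Gram matrix by `p`.

For the risk, it suffices to find one measurement whose Fisher information is a fixed multiple of
the QFIM. The effects `1 ± (|ψ_θ⟩⟨e| + |e⟩⟨ψ_θ|) / 2`, with `e` ranging over the projections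
onto `ψ_θ^⊥` of a real orthonormal basis, give the QFIM divided by `4 dim_ℝ H`.
-/

namespace QLearn

open ContinuousLinearMap InnerProductSpace

variable {G G' H : Type*} [NormedAddCommGroup G] [InnerProductSpace ℂ G]
  [NormedAddCommGroup G'] [InnerProductSpace ℂ G']
  [NormedAddCommGroup H] [InnerProductSpace ℂ H] [CompleteSpace H] {M : ℕ}

/-! ### Horizontal derivatives -/

lemma inner_starProjection_orthogonal_span_singleton (u x y : G) :
    inner ℂ ((ℂ ∙ u)ᗮ.starProjection x) ((ℂ ∙ u)ᗮ.starProjection y) =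
      inner ℂ x y - inner ℂ x u * inner ℂ u y / (‖u‖ ^ 2 : ℝ) := by
  rw [Submodule.inner_starProjection_left_eq_right,
    Submodule.starProjection_eq_self_iff.2 (Submodule.starProjection_apply_mem _ y),
    Submodule.starProjection_orthogonal_val, Submodule.starProjection_singleton, inner_sub_right,
    inner_smul_right]
  simp only [Complex.coe_algebraMap]
  ring

section PartialDeriv

variable {E F : Type*} [NormedAddCommGroup E] [NormedSpace ℝ E] [NormedAddCommGroup F]
  [NormedSpace ℝ F] {f : (Fin M → ℝ) → E} {θ : Fin M → ℝ}

lemma hasDerivAt_partialDeriv (hf : DifferentiableAt ℝ f θ) (i : Fin M) :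
    HasDerivAt (fun s : ℝ => f (Function.update θ i s)) (partialDeriv i f θ) (θ i) := by
  refine DifferentiableAt.hasDerivAt (DifferentiableAt.comp (θ i) ?_
    (hasDerivAt_update θ i (θ i)).differentiableAt)
  rwa [Function.update_eq_self]

lemma partialDeriv_clm_comp (L : E →L[ℝ] F) (hf : DifferentiableAt ℝ f θ) (i : Fin M) :
    partialDeriv i (fun η => L (f η)) θ = L (partialDeriv i f θ) :=
  (L.hasFDerivAt.comp_hasDerivAt (θ i) (hasDerivAt_partialDeriv hf i)).deriv

lemma partialDeriv_smul {c : (Fin M → ℝ) → ℝ} (hc : DifferentiableAt ℝ c θ)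
    (hf : DifferentiableAt ℝ f θ) (i : Fin M) :
    partialDeriv i (fun η => c η • f η) θ =
      c θ • partialDeriv i f θ + partialDeriv i c θ • f θ := by
  refine ((hasDerivAt_partialDeriv hc i).smul (hasDerivAt_partialDeriv hf i)).deriv.trans ?_
  rw [Function.update_eq_self]

end PartialDeriv

/-- The horizontal part of `∂ᵢψ` at `θ`: its component orthogonal to `ψ θ`. The QFIM depends on
the derivatives of the family only through it. -/
noncomputable def horizDeriv (i : Fin M) (ψ : (Fin M → ℝ) → G) (θ : Fin M → ℝ) : G :=
  (ℂ ∙ ψ θ)ᗮ.starProjection (partialDeriv i ψ θ)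

section HorizDeriv

variable {ψ : (Fin M → ℝ) → G} {θ : Fin M → ℝ}

lemma inner_horizDeriv_right (i : Fin M) (ψ : (Fin M → ℝ) → G) (θ : Fin M → ℝ) :
    inner ℂ (ψ θ) (horizDeriv i ψ θ) = 0 :=
  Submodule.mem_orthogonal_singleton_iff_inner_right.1 (Submodule.starProjection_apply_mem _ _)

lemma inner_horizDeriv_left (i : Fin M) (ψ : (Fin M → ℝ) → G) (θ : Fin M → ℝ) :
    inner ℂ (horizDeriv i ψ θ) (ψ θ) = 0 :=
  inner_eq_zero_symm.1 (inner_horizDeriv_right i ψ θ)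

lemma horizDeriv_smul {c : (Fin M → ℝ) → ℝ} (hc : DifferentiableAt ℝ c θ) (hcθ : c θ ≠ 0)
    (hψ : DifferentiableAt ℝ ψ θ) (i : Fin M) :
    horizDeriv i (fun η => c η • ψ η) θ = c θ • horizDeriv i ψ θ := by
  have hspan : (ℂ ∙ c θ • ψ θ) = ℂ ∙ ψ θ := by
    rw [← Complex.coe_smul,
      Submodule.span_singleton_smul_eq (IsUnit.mk0 _ (Complex.ofReal_ne_zero.2 hcθ))]
  simp only [horizDeriv, hspan]
  rw [partialDeriv_smul hc hψ, map_add, ← Complex.coe_smul, ← Complex.coe_smul, map_smul, map_smul,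
    Submodule.starProjection_orthogonalComplement_singleton_eq_zero, smul_zero, add_zero,
    Complex.coe_smul]

lemma horizDeriv_clm_comp (K : G →L[ℂ] G') (hψ : DifferentiableAt ℝ ψ θ) (i : Fin M) :
    horizDeriv i (fun η => K (ψ η)) θ =
      (ℂ ∙ K (ψ θ))ᗮ.starProjection (K (horizDeriv i ψ θ)) := by
  have hK : partialDeriv i (fun η => K (ψ η)) θ = K (partialDeriv i ψ θ) :=
    partialDeriv_clm_comp (K.restrictScalars ℝ) hψ i
  rw [horizDeriv, horizDeriv, hK, (ℂ ∙ ψ θ).starProjection_orthogonal_val,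
    Submodule.starProjection_singleton, map_sub, map_sub, map_smul, map_smul,
    Submodule.starProjection_orthogonalComplement_singleton_eq_zero, smul_zero, sub_zero]

lemma qfim_eq_re_inner_horizDeriv (hψ : ‖ψ θ‖ = 1) (i j : Fin M) :
    qfim ψ θ i j = 4 * (inner ℂ (horizDeriv i ψ θ) (horizDeriv j ψ θ)).re := by
  simp only [qfim, Matrix.of_apply, horizDeriv, inner_starProjection_orthogonal_span_singleton, hψ,
    one_pow, Complex.ofReal_one, div_one]

lemma abs_qfim_le (hψ : ‖ψ θ‖ = 1) (i j : Fin M) :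
    |qfim ψ θ i j| ≤ 4 * (‖horizDeriv i ψ θ‖ * ‖horizDeriv j ψ θ‖) := by
  rw [qfim_eq_re_inner_horizDeriv hψ, abs_mul, abs_of_pos (four_pos (α := ℝ))]
  gcongr
  exact (Complex.abs_re_le_norm _).trans (norm_inner_le_norm _ _)

lemma posSemidef_qfim (hψ : ‖ψ θ‖ = 1) : (qfim ψ θ).PosSemidef := by
  let : InnerProductSpace ℝ G := InnerProductSpace.rclikeToReal ℂ G
  have hgram : qfim ψ θ = (4 : ℝ) • Matrix.gram ℝ fun i => horizDeriv i ψ θ := by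
    ext i j
    exact qfim_eq_re_inner_horizDeriv hψ i j
  rw [hgram]
  exact (Matrix.posSemidef_gram ℝ _).smul zero_le_four

end HorizDeriv

/-! ### Postselection -/

/-- The family of normalized states obtained from the states `ψ η` by postselection with the Kraus
operator `K`. The states at which `K (ψ η) = 0` are sent to `0`. -/
noncomputable def postselected (K : G →L[ℂ] G') (ψ : (Fin M → ℝ) → G) (η : Fin M → ℝ) : G' :=
  ‖K (ψ η)‖⁻¹ • K (ψ η)

section Postselected

variable {ψ : (Fin M → ℝ) → G} {θ : Fin M → ℝ} {K : G →L[ℂ] G'}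

lemma norm_postselected (hK : K (ψ θ) ≠ 0) : ‖postselected K ψ θ‖ = 1 := by
  rw [postselected, norm_smul, norm_inv, norm_norm, inv_mul_cancel₀ (norm_ne_zero_iff.2 hK)]

lemma differentiableAt_clm_comp (K : G →L[ℂ] G') (hψ : DifferentiableAt ℝ ψ θ) :
    DifferentiableAt ℝ (fun η => K (ψ η)) θ :=
  (K.restrictScalars ℝ).differentiableAt.comp θ hψ

lemma differentiableAt_inv_norm_clm_comp (hψ : DifferentiableAt ℝ ψ θ) (hK : K (ψ θ) ≠ 0) :
    DifferentiableAt ℝ (fun η => ‖K (ψ η)‖⁻¹) θ :=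
  ((differentiableAt_clm_comp K hψ).norm ℂ hK).inv (norm_ne_zero_iff.2 hK)

lemma differentiableAt_postselected (hψ : DifferentiableAt ℝ ψ θ) (hK : K (ψ θ) ≠ 0) :
    DifferentiableAt ℝ (postselected K ψ) θ :=
  (differentiableAt_inv_norm_clm_comp hψ hK).smul (differentiableAt_clm_comp K hψ)

lemma horizDeriv_postselected (hψ : DifferentiableAt ℝ ψ θ) (hK : K (ψ θ) ≠ 0) (i : Fin M) :
    horizDeriv i (postselected K ψ) θ =
      ‖K (ψ θ)‖⁻¹ • (ℂ ∙ K (ψ θ))ᗮ.starProjection (K (horizDeriv i ψ θ)) := by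
  rw [← horizDeriv_clm_comp K hψ]
  exact horizDeriv_smul (differentiableAt_inv_norm_clm_comp hψ hK)
    (inv_ne_zero (norm_ne_zero_iff.2 hK)) (differentiableAt_clm_comp K hψ) i

lemma qfim_postselected (hψ : DifferentiableAt ℝ ψ θ) (hK : K (ψ θ) ≠ 0) (i j : Fin M) :
    ‖K (ψ θ)‖ ^ 2 * qfim (postselected K ψ) θ i j =
      4 * (inner ℂ (K (horizDeriv i ψ θ)) (K (horizDeriv j ψ θ)) -
        inner ℂ (K (horizDeriv i ψ θ)) (K (ψ θ)) * inner ℂ (K (ψ θ)) (K (horizDeriv j ψ θ)) /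
          (‖K (ψ θ)‖ ^ 2 : ℝ)).re := by
  have hne : ‖K (ψ θ)‖ ≠ 0 := norm_ne_zero_iff.2 hK
  rw [qfim_eq_re_inner_horizDeriv (norm_postselected hK), horizDeriv_postselected hψ hK,
    horizDeriv_postselected hψ hK, ← Complex.coe_smul, ← Complex.coe_smul, inner_smul_left,
    inner_smul_right, inner_starProjection_orthogonal_span_singleton, Complex.conj_ofReal,
    Complex.re_ofReal_mul, Complex.re_ofReal_mul]
  field_simp

end Postselected

/-! ### The distilling operator -/

/-- The operator that acts as multiplication by `t` on the line through the unit vector `φ` and as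
the identity on its orthogonal complement: the Kraus operator `(t - 1) |φ⟩⟨φ| + 1`. -/
noncomputable def distillOp (φ : G) (t : ℝ) : G →L[ℂ] G :=
  ((t - 1 : ℝ) : ℂ) • rankOne ℂ φ φ + 1

section DistillOp

variable {φ v : G} {t : ℝ}

lemma inner_distillOp (hφ : ‖φ‖ = 1) (t : ℝ) (x y : G) :
    inner ℂ (distillOp φ t x) (distillOp φ t y) =
      inner ℂ x y - ((1 - t ^ 2 : ℝ) : ℂ) * (inner ℂ x φ * inner ℂ φ y) := by
  have hφφ : inner ℂ φ φ = (1 : ℂ) := inner_self_eq_one_of_norm_eq_one hφ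
  simp only [distillOp, add_apply, smul_apply, rankOne_apply, one_apply_eq_self, inner_add_left,
    inner_add_right, inner_smul_left, inner_smul_right, hφφ, inner_conj_symm, Complex.conj_ofReal]
  push_cast
  ring

lemma norm_distillOp_sq (hφ : ‖φ‖ = 1) (t : ℝ) (v : G) :
    ‖distillOp φ t v‖ ^ 2 =
      t ^ 2 * ‖v‖ ^ 2 + (1 - t ^ 2) * ‖(ℂ ∙ φ)ᗮ.starProjection v‖ ^ 2 := by
  have hK : inner ℂ (distillOp φ t v) (distillOp φ t v) = ((t ^ 2 : ℝ) : ℂ) * inner ℂ v v +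
      ((1 - t ^ 2 : ℝ) : ℂ) * inner ℂ ((ℂ ∙ φ)ᗮ.starProjection v) ((ℂ ∙ φ)ᗮ.starProjection v) := by
    rw [inner_distillOp hφ, inner_starProjection_orthogonal_span_singleton, hφ]
    push_cast
    ring
  simp only [inner_self_eq_norm_sq_to_K, Complex.coe_algebraMap] at hK
  exact_mod_cast hK

lemma sq_mul_norm_sq_le_norm_distillOp_sq (hφ : ‖φ‖ = 1) (ht : t ∈ Set.Icc (0 : ℝ) 1) (v : G) :
    t ^ 2 * ‖v‖ ^ 2 ≤ ‖distillOp φ t v‖ ^ 2 := by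
  rw [norm_distillOp_sq hφ]
  have : 0 ≤ 1 - t ^ 2 := sub_nonneg.2 (pow_le_one₀ ht.1 ht.2)
  exact le_add_of_nonneg_right (by positivity)

lemma norm_distillOp_sq_sub_le (hφ : ‖φ‖ = 1) (t : ℝ) (v : G) :
    ‖distillOp φ t v‖ ^ 2 - t ^ 2 * ‖v‖ ^ 2 ≤ ‖v - φ‖ ^ 2 := by
  have hP : (ℂ ∙ φ)ᗮ.starProjection v = (ℂ ∙ φ)ᗮ.starProjection (v - φ) := by
    rw [map_sub, Submodule.starProjection_orthogonalComplement_singleton_eq_zero, sub_zero]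
  rw [norm_distillOp_sq hφ, add_sub_cancel_left, hP]
  calc (1 - t ^ 2) * ‖(ℂ ∙ φ)ᗮ.starProjection (v - φ)‖ ^ 2
      ≤ 1 * ‖v - φ‖ ^ 2 := by
        gcongr
        · exact sub_le_self _ (sq_nonneg t)
        · exact Submodule.norm_starProjection_apply_le _ _
    _ = ‖v - φ‖ ^ 2 := one_mul _

lemma distillOp_apply_ne_zero (hφ : ‖φ‖ = 1) (ht : t ∈ Set.Ioc (0 : ℝ) 1) (hv : v ≠ 0) :
    distillOp φ t v ≠ 0 := by
  have ht₀ : 0 < t := ht.1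
  have hle := sq_mul_norm_sq_le_norm_distillOp_sq hφ (Set.Ioc_subset_Icc_self ht) v
  refine norm_ne_zero_iff.1 (pow_ne_zero_iff two_ne_zero |>.1 (lt_of_lt_of_le ?_ hle).ne')
  have : 0 < ‖v‖ := norm_pos_iff.2 hv
  positivity

lemma isPositive_postF (K : H →L[ℂ] H) : (postF K).IsPositive :=
  isPositive_adjoint_comp_self K

lemma one_sub_postF_distillOp {φ : H} (hφ : ‖φ‖ = 1) (t : ℝ) :
    1 - postF (distillOp φ t) = ((1 - t ^ 2 : ℝ) : ℂ) • rankOne ℂ φ φ := by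
  ext y
  refine ext_inner_left ℂ fun x => ?_
  simp only [postF, sub_apply, smul_apply, one_apply_eq_self, mul_apply_eq_comp, inner_sub_right,
    adjoint_inner_right, inner_distillOp hφ, rankOne_apply, inner_smul_right]
  ring

lemma isPositive_one_sub_postF_distillOp {φ : H} (hφ : ‖φ‖ = 1) (ht : t ∈ Set.Icc (0 : ℝ) 1) :
    (1 - postF (distillOp φ t)).IsPositive := by
  rw [one_sub_postF_distillOp hφ]
  refine (isPositive_rankOne_self φ).smul_of_nonneg ?_
  rw [Complex.zero_le_real, sub_nonneg]
  exact pow_le_one₀ ht.1 ht.2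

end DistillOp

section Distilled

variable {ψ : (Fin M → ℝ) → G} {θ : Fin M → ℝ} {φ : G} {t : ℝ}

lemma abs_re_inner_mul_inner_le {v x y : G} (hx : inner ℂ x v = 0) (hy : inner ℂ v y = 0)
    (φ : G) : |(inner ℂ x φ * inner ℂ φ y).re| ≤ ‖x‖ * ‖y‖ * ‖v - φ‖ ^ 2 := by
  have hxφ : inner ℂ x φ = -inner ℂ x (v - φ) := by rw [inner_sub_right, hx, zero_sub, neg_neg]
  have hyφ : inner ℂ φ y = -inner ℂ (v - φ) y := by rw [inner_sub_left, hy, zero_sub, neg_neg]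
  calc |(inner ℂ x φ * inner ℂ φ y).re|
      ≤ ‖inner ℂ x (v - φ)‖ * ‖inner ℂ (v - φ) y‖ := by
        rw [hxφ, hyφ, neg_mul_neg, ← norm_mul]
        exact Complex.abs_re_le_norm _
    _ ≤ (‖x‖ * ‖v - φ‖) * (‖v - φ‖ * ‖y‖) := by gcongr <;> exact norm_inner_le_norm _ _
    _ = ‖x‖ * ‖y‖ * ‖v - φ‖ ^ 2 := by ring

lemma qfim_postselected_distillOp (hφ : ‖φ‖ = 1) (hψ : ‖ψ θ‖ = 1) (hd : DifferentiableAt ℝ ψ θ)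
    (hK : distillOp φ t (ψ θ) ≠ 0) (i j : Fin M) :
    ‖distillOp φ t (ψ θ)‖ ^ 2 * qfim (postselected (distillOp φ t) ψ) θ i j =
      qfim ψ θ i j - 4 * ((1 - t ^ 2) / ‖distillOp φ t (ψ θ)‖ ^ 2 *
        (inner ℂ (horizDeriv i ψ θ) φ * inner ℂ φ (horizDeriv j ψ θ)).re) := by
  set p : ℝ := ‖distillOp φ t (ψ θ)‖ ^ 2 with hp
  have hp₀ : (p : ℂ) ≠ 0 := Complex.ofReal_ne_zero.2 (pow_ne_zero 2 (norm_ne_zero_iff.2 hK))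
  have hp_inner : (p : ℂ) = 1 - ((1 - t ^ 2 : ℝ) : ℂ) * (inner ℂ (ψ θ) φ * inner ℂ φ (ψ θ)) := by
    rw [← inner_self_eq_one_of_norm_eq_one (𝕜 := ℂ) hψ, ← inner_distillOp hφ,
      inner_self_eq_norm_sq_to_K, hp]
    push_cast
    rfl
  rw [qfim_postselected hd hK, qfim_eq_re_inner_horizDeriv hψ, ← mul_sub, ← hp,
    ← Complex.re_ofReal_mul ((1 - t ^ 2) / p), ← Complex.sub_re]
  simp only [inner_distillOp hφ, inner_horizDeriv_left, inner_horizDeriv_right]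
  congr 2
  rw [Complex.ofReal_div, sub_sub]
  congr 1
  field_simp
  rw [hp_inner]
  ring

lemma abs_mul_qfim_sub_le (hφ : ‖φ‖ = 1) (hψ : ‖ψ θ‖ = 1) (hd : DifferentiableAt ℝ ψ θ)
    (ht : t ∈ Set.Ioc (0 : ℝ) 1) (i j : Fin M) :
    |‖distillOp φ t (ψ θ)‖ ^ 2 * qfim (postselected (distillOp φ t) ψ) θ i j - qfim ψ θ i j| ≤
      4 * (‖horizDeriv i ψ θ‖ * ‖horizDeriv j ψ θ‖) * ‖ψ θ - φ‖ ^ 2 / t ^ 2 := by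
  have ht₀ : 0 < t := ht.1
  have htp := sq_mul_norm_sq_le_norm_distillOp_sq hφ (Set.Ioc_subset_Icc_self ht) (ψ θ)
  rw [hψ, one_pow, mul_one] at htp
  have hs : 0 ≤ 1 - t ^ 2 := sub_nonneg.2 (pow_le_one₀ ht₀.le ht.2)
  have hratio : (1 - t ^ 2) / ‖distillOp φ t (ψ θ)‖ ^ 2 ≤ 1 / t ^ 2 := by
    gcongr
    exact sub_le_self _ (sq_nonneg t)
  have hne : distillOp φ t (ψ θ) ≠ 0 :=
    distillOp_apply_ne_zero hφ ht (norm_ne_zero_iff.1 (hψ ▸ one_ne_zero))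
  rw [qfim_postselected_distillOp hφ hψ hd hne, sub_sub_cancel_left, abs_neg, abs_mul, abs_mul,
    abs_of_pos (four_pos (α := ℝ)), abs_of_nonneg (div_nonneg hs (sq_nonneg _))]
  calc _ ≤ 4 * (1 / t ^ 2 * (‖horizDeriv i ψ θ‖ * ‖horizDeriv j ψ θ‖ * ‖ψ θ - φ‖ ^ 2)) := by
        gcongr
        exact abs_re_inner_mul_inner_le (inner_horizDeriv_left i ψ θ)
          (inner_horizDeriv_right j ψ θ) φ
    _ = _ := by ring

lemma abs_sub_div_le_of_abs_mul_sub_le {p s a b ε η : ℝ} (hs : 0 < s) (hsp : s ≤ p)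
    (hp : p - s ≤ ε) (hab : |p * a - b| ≤ η) : |a - b / s| ≤ (η + |b| * (ε / s)) / s := by
  have hp₀ : 0 < p := hs.trans_le hsp
  have hpa : a - b / s = ((p * a - b) - b * ((p - s) / s)) / p := by field_simp; ring
  have hε : |(p - s) / s| ≤ ε / s := by
    rw [abs_div, abs_of_nonneg (sub_nonneg.2 hsp), abs_of_pos hs]
    gcongr
  rw [hpa, abs_div, abs_of_pos hp₀]
  have hnum : |(p * a - b) - b * ((p - s) / s)| ≤ η + |b| * (ε / s) := by
    refine (abs_sub _ _).trans ?_
    rw [abs_mul b]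
    gcongr
  exact div_le_div₀ ((abs_nonneg _).trans hnum) hnum hs hsp

lemma abs_qfim_sub_div_le (hφ : ‖φ‖ = 1) (hψ : ‖ψ θ‖ = 1) (hd : DifferentiableAt ℝ ψ θ)
    (ht : t ∈ Set.Ioc (0 : ℝ) 1) (i j : Fin M) :
    |qfim (postselected (distillOp φ t) ψ) θ i j - qfim ψ θ i j / t ^ 2| ≤
      8 * (‖horizDeriv i ψ θ‖ * ‖horizDeriv j ψ θ‖) * ‖ψ θ - φ‖ ^ 2 / t ^ 4 := by
  have ht₀ : 0 < t := ht.1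
  have htp := sq_mul_norm_sq_le_norm_distillOp_sq hφ (Set.Ioc_subset_Icc_self ht) (ψ θ)
  have hpt := norm_distillOp_sq_sub_le hφ t (ψ θ)
  rw [hψ, one_pow, mul_one] at htp hpt
  calc _ ≤ (4 * (‖horizDeriv i ψ θ‖ * ‖horizDeriv j ψ θ‖) * ‖ψ θ - φ‖ ^ 2 / t ^ 2 +
        |qfim ψ θ i j| * (‖ψ θ - φ‖ ^ 2 / t ^ 2)) / t ^ 2 :=
      abs_sub_div_le_of_abs_mul_sub_le (pow_pos ht₀ 2) htp hpt (abs_mul_qfim_sub_le hφ hψ hd ht i j)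
    _ ≤ (4 * (‖horizDeriv i ψ θ‖ * ‖horizDeriv j ψ θ‖) * ‖ψ θ - φ‖ ^ 2 / t ^ 2 +
        4 * (‖horizDeriv i ψ θ‖ * ‖horizDeriv j ψ θ‖) * (‖ψ θ - φ‖ ^ 2 / t ^ 2)) / t ^ 2 := by
      gcongr
      exact abs_qfim_le hψ i j
    _ = _ := by field_simp; ring

end Distilled

section DistilledFamily

variable {ψ : (Fin M → ℝ) → G} {θ : Fin M → ℝ}

lemma exists_norm_sub_le_mul_of_bounded {E F : Type*} [NormedAddCommGroup E] [NormedSpace ℝ E]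
    [NormedAddCommGroup F] [NormedSpace ℝ F] {f : E → F} {x : E} {R : ℝ}
    (hf : DifferentiableAt ℝ f x) (hR : ∀ y, ‖f y‖ ≤ R) :
    ∃ L : ℝ, ∀ y, ‖f y - f x‖ ≤ L * ‖y - x‖ := by
  obtain ⟨c, hc⟩ := hf.isBigO_sub.bound
  obtain ⟨r, hr, hnear⟩ := Metric.eventually_nhds_iff.1 hc
  refine ⟨max c ((R + R) / r), fun y => ?_⟩
  rcases lt_or_ge (dist y x) r with h | h
  · refine (hnear h).trans ?_
    gcongr
    exact le_max_left _ _
  · rw [dist_eq_norm] at h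
    have hR₀ : 0 ≤ R := (norm_nonneg _).trans (hR x)
    calc ‖f y - f x‖ ≤ R + R := (norm_sub_le _ _).trans (add_le_add (hR y) (hR x))
      _ = (R + R) / r * r := (div_mul_cancel₀ _ hr.ne').symm
      _ ≤ max c ((R + R) / r) * ‖y - x‖ := by
        gcongr
        exact le_max_right _ _

lemma exists_distillation_bounds (hψ : ∀ η, ‖ψ η‖ = 1) (hd : DifferentiableAt ℝ ψ θ) :
    ∃ C : ℝ, ∀ θ₀ : Fin M → ℝ,
      (∀ t ∈ Set.Icc (0 : ℝ) 1,
        |‖distillOp (ψ θ₀) t (ψ θ)‖ ^ 2 - t ^ 2| ≤ C * ‖θ - θ₀‖ ^ 2) ∧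
      ∀ t ∈ Set.Ioc (0 : ℝ) 1,
        0 < ‖distillOp (ψ θ₀) t (ψ θ)‖ ^ 2 ∧
        ∀ i j : Fin M,
          |qfim (postselected (distillOp (ψ θ₀) t) ψ) θ i j - qfim ψ θ i j / t ^ 2| ≤
            C * ‖θ - θ₀‖ ^ 2 / t ^ 4 ∧
          |‖distillOp (ψ θ₀) t (ψ θ)‖ ^ 2 * qfim (postselected (distillOp (ψ θ₀) t) ψ) θ i j -
            qfim ψ θ i j| ≤ C * ‖θ - θ₀‖ ^ 2 / t ^ 2 := by
  obtain ⟨L, hL⟩ := exists_norm_sub_le_mul_of_bounded hd fun η => (hψ η).le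
  set D : ℝ := ‖fun k => horizDeriv k ψ θ‖
  have hD : ∀ k, ‖horizDeriv k ψ θ‖ ≤ D := norm_le_pi_norm fun k => horizDeriv k ψ θ
  have hθ₀ : ∀ θ₀, ‖ψ θ - ψ θ₀‖ ^ 2 ≤ L ^ 2 * ‖θ - θ₀‖ ^ 2 := fun θ₀ => by
    rw [← mul_pow, norm_sub_rev, norm_sub_rev θ]
    exact pow_le_pow_left₀ (norm_nonneg _) (hL θ₀) 2
  have hC : ∀ {b : ℝ} (θ₀ : Fin M → ℝ), b ≤ 1 + 8 * D ^ 2 →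
      b * ‖ψ θ - ψ θ₀‖ ^ 2 ≤ (1 + 8 * D ^ 2) * L ^ 2 * ‖θ - θ₀‖ ^ 2 := fun θ₀ hb => by
    rw [mul_assoc]
    exact mul_le_mul hb (hθ₀ θ₀) (sq_nonneg _) (by positivity)
  have hDD : ∀ i j, ‖horizDeriv i ψ θ‖ * ‖horizDeriv j ψ θ‖ ≤ D ^ 2 := fun i j => by
    rw [sq]
    exact mul_le_mul (hD i) (hD j) (norm_nonneg _) (norm_nonneg _)
  refine ⟨(1 + 8 * D ^ 2) * L ^ 2, fun θ₀ =>
    ⟨fun t ht => ?_, fun t ht => ⟨?_, fun i j => ⟨?_, ?_⟩⟩⟩⟩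
  · have hlow := sq_mul_norm_sq_le_norm_distillOp_sq (hψ θ₀) ht (ψ θ)
    have hup := norm_distillOp_sq_sub_le (hψ θ₀) t (ψ θ)
    rw [hψ, one_pow, mul_one] at hlow hup
    rw [abs_of_nonneg (sub_nonneg.2 hlow)]
    exact hup.trans ((one_mul _).symm.trans_le (hC θ₀ (le_add_of_nonneg_right (by positivity))))
  · have := norm_pos_iff.2
      (distillOp_apply_ne_zero (hψ θ₀) ht (norm_ne_zero_iff.1 ((hψ θ).trans_ne one_ne_zero)))
    positivity
  · refine (abs_qfim_sub_div_le (hψ θ₀) (hψ θ) hd ht i j).trans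
      (div_le_div_of_nonneg_right (hC θ₀ ?_) (by positivity))
    linarith [hDD i j]
  · refine (abs_mul_qfim_sub_le (hψ θ₀) (hψ θ) hd ht i j).trans
      (div_le_div_of_nonneg_right (hC θ₀ ?_) (by positivity))
    linarith [hDD i j, sq_nonneg D]

variable {ι : Type*} {l : Filter ι} {t : ι → ℝ} {θ₀ : ι → Fin M → ℝ}

lemma tendsto_norm_distillOp_sq (hψ : ∀ η, ‖ψ η‖ = 1) (hd : DifferentiableAt ℝ ψ θ)
    (ht : Tendsto t l (𝓝[>] 0)) (hδ : Tendsto (fun n => ‖θ - θ₀ n‖ ^ 2 / t n ^ 2) l (𝓝 0)) :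
    Tendsto (fun n => ‖distillOp (ψ (θ₀ n)) (t n) (ψ θ)‖ ^ 2) l (𝓝[>] 0) := by
  obtain ⟨C, hC⟩ := exists_distillation_bounds hψ hd
  have htIoc : ∀ᶠ n in l, t n ∈ Set.Ioc (0 : ℝ) 1 := ht (Ioc_mem_nhdsGT one_pos)
  have ht₀ : Tendsto (fun n => t n ^ 2) l (𝓝 0) := by
    simpa using (tendsto_nhds_of_tendsto_nhdsWithin ht).pow 2
  refine tendsto_nhdsWithin_iff.2 ⟨?_, htIoc.mono fun n hn => ((hC _).2 _ hn).1⟩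
  have hbound : Tendsto (fun n => t n ^ 2 + C * (‖θ - θ₀ n‖ ^ 2 / t n ^ 2 * t n ^ 2)) l (𝓝 0) := by
    simpa using ht₀.add ((hδ.mul ht₀).const_mul C)
  refine squeeze_zero' (.of_forall fun n => sq_nonneg _) (htIoc.mono fun n hn => ?_) hbound
  rw [div_mul_cancel₀ _ (pow_ne_zero 2 hn.1.ne')]
  linarith [(abs_le.1 ((hC (θ₀ n)).1 _ (Set.Ioc_subset_Icc_self hn))).2]

lemma tendsto_smul_qfim_postselected (hψ : ∀ η, ‖ψ η‖ = 1) (hd : DifferentiableAt ℝ ψ θ)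
    (ht : Tendsto t l (𝓝[>] 0)) (hδ : Tendsto (fun n => ‖θ - θ₀ n‖ ^ 2 / t n ^ 2) l (𝓝 0)) :
    Tendsto (fun n => ‖distillOp (ψ (θ₀ n)) (t n) (ψ θ)‖ ^ 2 •
      qfim (postselected (distillOp (ψ (θ₀ n)) (t n)) ψ) θ) l (𝓝 (qfim ψ θ)) := by
  obtain ⟨C, hC⟩ := exists_distillation_bounds hψ hd
  have htIoc : ∀ᶠ n in l, t n ∈ Set.Ioc (0 : ℝ) 1 := ht (Ioc_mem_nhdsGT one_pos)
  refine tendsto_pi_nhds.2 fun i => tendsto_pi_nhds.2 fun j => tendsto_iff_dist_tendsto_zero.2 ?_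
  refine squeeze_zero' (.of_forall fun n => dist_nonneg) (htIoc.mono fun n hn => ?_)
    (by simpa using hδ.const_mul C)
  rw [← mul_div_assoc]
  exact (((hC (θ₀ n)).2 _ hn).2 i j).2

lemma eventually_postselected_normalized_differentiable (hψ : ∀ η, ‖ψ η‖ = 1)
    (hd : DifferentiableAt ℝ ψ θ) (ht : Tendsto t l (𝓝[>] 0)) (θ₀ : ι → Fin M → ℝ) :
    ∀ᶠ n in l, (∀ η, ‖postselected (distillOp (ψ (θ₀ n)) (t n)) ψ η‖ = 1) ∧
      DifferentiableAt ℝ (postselected (distillOp (ψ (θ₀ n)) (t n)) ψ) θ := by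
  have htIoc : ∀ᶠ n in l, t n ∈ Set.Ioc (0 : ℝ) 1 := ht (Ioc_mem_nhdsGT one_pos)
  refine htIoc.mono fun n hn => ?_
  have hK : ∀ η, distillOp (ψ (θ₀ n)) (t n) (ψ η) ≠ 0 := fun η =>
    distillOp_apply_ne_zero (hψ _) hn (norm_ne_zero_iff.1 ((hψ η).trans_ne one_ne_zero))
  exact ⟨fun η => norm_postselected (hK η), differentiableAt_postselected hd (hK θ)⟩

end DistilledFamily

/-! ### The encoded states -/

section EncState

variable {A : Fin M → H →L[ℂ] H}

lemma differentiable_exp_I_smul (B : H →L[ℂ] H) :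
    Differentiable ℝ fun s : ℝ => NormedSpace.exp ((Complex.I * (s : ℂ)) • B) := by
  intro s
  have hexp := hasDerivAt_exp_smul_const (𝕂 := ℂ) B (Complex.I * (s : ℂ))
  have hphase : HasDerivAt (fun s : ℝ => Complex.I * (s : ℂ)) (Complex.I * 1) s :=
    (Complex.ofRealCLM.hasDerivAt (x := s)).const_mul Complex.I
  exact (hexp.scomp s hphase).differentiableAt

lemma exp_I_smul_mem_unitary {B : H →L[ℂ] H} (hB : IsSelfAdjoint B) (s : ℝ) :
    NormedSpace.exp ((Complex.I * (s : ℂ)) • B) ∈ unitary (H →L[ℂ] H) := by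
  let +nondep : NormedAlgebra ℚ (H →L[ℂ] H) := .restrictScalars ℚ ℂ _
  refine NormedSpace.exp_mem_unitary_of_mem_skewAdjoint (skewAdjoint.mem_iff.2 ?_)
  simp only [star_smul, hB.star_eq, star_mul', RCLike.star_def, Complex.conj_I,
    Complex.conj_ofReal, neg_mul, neg_smul]

lemma encU_mem_unitary (hA : ∀ m, IsSelfAdjoint (A m)) (θ : Fin M → ℝ) :
    encU A θ ∈ unitary (H →L[ℂ] H) := by
  refine list_prod_mem fun U hU => ?_
  obtain ⟨m, rfl⟩ := List.mem_ofFn.1 (List.mem_reverse.1 hU)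
  exact exp_I_smul_mem_unitary (hA m) (θ m)

lemma differentiable_encU (A : Fin M → H →L[ℂ] H) : Differentiable ℝ (encU A) := by
  have hmap : encU A = fun θ : Fin M → ℝ => ((List.finRange M).reverse.map fun m =>
      NormedSpace.exp ((Complex.I * (θ m : ℂ)) • A m)).prod := by
    ext1 θ
    rw [encU, List.ofFn_eq_map, List.map_reverse]
  rw [hmap]
  exact fun θ => HasFDerivAt.differentiableAt (HasFDerivAt.list_prod' fun m _ =>
    ((differentiable_exp_I_smul (A m)).comp (differentiable_apply m) θ).hasFDerivAt)

lemma differentiable_encState (A : Fin M → H →L[ℂ] H) (ψ₀ : H) :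
    Differentiable ℝ (encState A ψ₀) :=
  ((ContinuousLinearMap.apply ℂ H ψ₀).restrictScalars ℝ).differentiable.comp (differentiable_encU A)

lemma norm_encState (hA : ∀ m, IsSelfAdjoint (A m)) (ψ₀ : H) (θ : Fin M → ℝ) :
    ‖encState A ψ₀ θ‖ = ‖ψ₀‖ :=
  norm_map_of_mem_unitary (encU_mem_unitary hA θ) ψ₀

lemma encRho_eq_rankOne (A : Fin M → H →L[ℂ] H) (ψ₀ : H) (θ : Fin M → ℝ) :
    encRho A ψ₀ θ = rankOne ℂ (encState A ψ₀ θ) (encState A ψ₀ θ) := by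
  rw [encRho, mul_def, mul_def, comp_rankOne, rankOne_comp, adjoint_adjoint, encState]

lemma distK_eq_distillOp (A : Fin M → H →L[ℂ] H) (ψ₀ : H) (θ₀ : Fin M → ℝ) (t : ℝ) :
    distK A ψ₀ θ₀ t = distillOp (encState A ψ₀ θ₀) t := by
  rw [distK, encRho_eq_rankOne, distillOp]

variable [FiniteDimensional ℂ H]

lemma postProb_eq_norm_sq (K : H →L[ℂ] H) (A : Fin M → H →L[ℂ] H) (ψ₀ : H) (θ : Fin M → ℝ) :
    postProb K A ψ₀ θ = ‖K (encState A ψ₀ θ)‖ ^ 2 := by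
  rw [postProb, encRho_eq_rankOne, mul_def, comp_rankOne, trace_rankOne, postF, mul_def,
    comp_apply, adjoint_inner_right, inner_self_eq_norm_sq_to_K]
  norm_cast

lemma distProb_eq_norm_sq (A : Fin M → H →L[ℂ] H) (ψ₀ : H) (θ₀ : Fin M → ℝ) (t : ℝ)
    (θ : Fin M → ℝ) :
    distProb A ψ₀ θ₀ t θ = ‖distillOp (encState A ψ₀ θ₀) t (encState A ψ₀ θ)‖ ^ 2 := by
  rw [distProb, postProb_eq_norm_sq, distK_eq_distillOp]

lemma distState_eq_postselected (A : Fin M → H →L[ℂ] H) (ψ₀ : H) (θ₀ : Fin M → ℝ) (t : ℝ) :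
    distState A ψ₀ θ₀ t = postselected (distillOp (encState A ψ₀ θ₀) t) (encState A ψ₀) := by
  ext η
  rw [distState, postState, postProb_eq_norm_sq, Real.sqrt_sq (norm_nonneg _), Complex.coe_smul,
    distK_eq_distillOp, postselected]

end EncState

/-! ### Tilt measurements -/

/-- The effect `1 + (|u⟩⟨e| + |e⟩⟨u|) / 2`, up to normalization. In a state `ψ` near `u`, its
expectation responds to first order to the component of `ψ` along `e`. -/
noncomputable def tiltEffect (u e : G) : G →L[ℂ] G :=
  1 + (2⁻¹ : ℂ) • (rankOne ℂ u e + rankOne ℂ e u)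

lemma inner_tiltEffect (u e x : G) :
    inner ℂ x (tiltEffect u e x) = ((‖x‖ ^ 2 + (inner ℂ x u * inner ℂ e x).re : ℝ) : ℂ) := by
  have hre : inner ℂ x u * inner ℂ e x + inner ℂ x e * inner ℂ u x =
      ((2 * (inner ℂ x u * inner ℂ e x).re : ℝ) : ℂ) := by
    rw [← Complex.add_conj, map_mul, inner_conj_symm, inner_conj_symm, mul_comm (inner ℂ u x)]
  simp only [tiltEffect, add_apply, smul_apply, one_apply_eq_self, rankOne_apply, inner_smul_right,
    inner_add_right, inner_self_eq_norm_sq_to_K, Complex.coe_algebraMap]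
  rw [mul_comm (inner ℂ e x), mul_comm (inner ℂ u x), hre]
  push_cast
  ring

lemma isPositive_tiltEffect {u e : G} (hu : ‖u‖ = 1) (he : ‖e‖ ≤ 1) :
    (tiltEffect u e).IsPositive := by
  rw [isPositive_iff_complex]
  intro x
  rw [← inner_conj_symm, inner_tiltEffect, Complex.conj_ofReal]
  refine ⟨by rw [RCLike.re_to_complex, Complex.ofReal_re], ?_⟩
  have hcross : |(inner ℂ x u * inner ℂ e x).re| ≤ ‖x‖ ^ 2 := by
    calc _ ≤ ‖inner ℂ x u‖ * ‖inner ℂ e x‖ := by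
          rw [← norm_mul]
          exact Complex.abs_re_le_norm _
      _ ≤ (‖x‖ * ‖u‖) * (‖e‖ * ‖x‖) := by gcongr <;> exact norm_inner_le_norm _ _
      _ ≤ (‖x‖ * 1) * (1 * ‖x‖) := by rw [hu]; gcongr
      _ = ‖x‖ ^ 2 := by ring
  rw [RCLike.re_to_complex, Complex.ofReal_re]
  exact neg_le_iff_add_nonneg'.1 (abs_le.1 hcross).1

/-- The measurement with `n` equally weighted tilt effects, in the directions `e k`. -/
noncomputable def tiltMeasurement {n : ℕ} (hn : n ≠ 0) {u : H} (hu : ‖u‖ = 1) {e : Fin n → H}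
    (he : ∀ k, ‖e k‖ ≤ 1) (hsum : ∑ k, e k = 0) : Measurement H n where
  effect k := (((n : ℝ)⁻¹ : ℝ) : ℂ) • tiltEffect u (e k)
  isPositive k := (isPositive_tiltEffect hu (he k)).smul_of_nonneg
    (Complex.zero_le_real.2 (by positivity))
  sum_eq_one := by
    have hn' : (n : ℂ) ≠ 0 := Nat.cast_ne_zero.2 hn
    have hleft : ∑ k, rankOne ℂ u (e k) = 0 := by rw [← map_sum, hsum, map_zero]
    have hright : ∑ k, rankOne ℂ (e k) u = 0 := by
      rw [← sum_apply, ← map_sum, hsum, map_zero, zero_apply]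
    simp only [tiltEffect, ← Finset.smul_sum, Finset.sum_add_distrib, hleft, hright, add_zero,
      smul_zero, Finset.sum_const, Finset.card_univ, Fintype.card_fin]
    rw [← Nat.cast_smul_eq_nsmul ℂ, smul_smul, Complex.ofReal_inv, Complex.ofReal_natCast,
      inv_mul_cancel₀ hn', one_smul]

lemma partialDeriv_log_tilt {ψ : (Fin M → ℝ) → G} {θ : Fin M → ℝ} (hψ : ∀ η, ‖ψ η‖ = 1)
    (hd : DifferentiableAt ℝ ψ θ) {c : ℝ} (hc : c ≠ 0) {e : G} (he : inner ℂ e (ψ θ) = 0)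
    (i : Fin M) :
    partialDeriv i (fun η => Real.log (c * (‖ψ η‖ ^ 2 +
      (inner ℂ (ψ η) (ψ θ) * inner ℂ e (ψ η)).re))) θ = (inner ℂ (partialDeriv i ψ θ) e).re := by
  have hψi := hasDerivAt_partialDeriv hd i
  have hcross := Complex.reCLM.hasFDerivAt.comp_hasDerivAt (θ i)
    ((hψi.inner ℂ (hasDerivAt_const (θ i) (ψ θ))).mul
      ((hasDerivAt_const (θ i) e).inner ℂ hψi))
  have hlog := ((hcross.const_add 1).const_mul c).log (by simp [he, hc])
  simp only [hψ, one_pow]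
  refine hlog.deriv.trans ?_
  simp only [Pi.mul_apply, Function.comp_apply, Function.update_eq_self, he,
    inner_self_eq_one_of_norm_eq_one (hψ θ), inner_zero_left, inner_zero_right, zero_add, add_zero,
    mul_zero, one_mul, Complex.reCLM_apply, Complex.zero_re, mul_one]
  rw [mul_div_cancel_left₀ _ hc, ← inner_conj_symm, Complex.conj_re]

lemma exists_norm_eq_one_sum_re_inner_mul_re_inner (G : Type*) [NormedAddCommGroup G]
    [InnerProductSpace ℂ G] [FiniteDimensional ℂ G] :
    ∃ b : Fin (Module.finrank ℝ G) → G, (∀ a, ‖b a‖ = 1) ∧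
      ∀ x y, ∑ a, (inner ℂ x (b a)).re * (inner ℂ y (b a)).re = (inner ℂ x y).re := by
  have : FiniteDimensional ℝ G := FiniteDimensional.complexToReal G
  let : InnerProductSpace ℝ G := InnerProductSpace.rclikeToReal ℂ G
  let b := stdOrthonormalBasis ℝ G
  refine ⟨b, b.orthonormal.1, fun x y => ?_⟩
  calc _ = ∑ a, inner ℝ x (b a) * inner ℝ (b a) y :=
        Finset.sum_congr rfl fun a _ => congrArg _ (real_inner_comm (b a) y)
    _ = inner ℝ x y := b.sum_inner_mul_inner x y

section Fisher

variable {ψ : (Fin M → ℝ) → H} {θ : Fin M → ℝ} {n : ℕ} {e : Fin n → H}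

lemma outcomeProb_tiltMeasurement (hn : n ≠ 0) {u : H} (hu : ‖u‖ = 1) (he : ∀ k, ‖e k‖ ≤ 1)
    (hsum : ∑ k, e k = 0) (ψ : (Fin M → ℝ) → H) (k : Fin n) (η : Fin M → ℝ) :
    outcomeProb (tiltMeasurement hn hu he hsum) ψ k η =
      (n : ℝ)⁻¹ * (‖ψ η‖ ^ 2 + (inner ℂ (ψ η) u * inner ℂ (e k) (ψ η)).re) := by
  rw [outcomeProb, tiltMeasurement, smul_apply, inner_smul_right, inner_tiltEffect]
  norm_cast

lemma fisher_tiltMeasurement (hψ : ∀ η, ‖ψ η‖ = 1) (hd : DifferentiableAt ℝ ψ θ) (hn : n ≠ 0)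
    (he : ∀ k, ‖e k‖ ≤ 1) (hsum : ∑ k, e k = 0) (heψ : ∀ k, inner ℂ (e k) (ψ θ) = 0)
    (i j : Fin M) :
    fisher (tiltMeasurement hn (hψ θ) he hsum) ψ θ i j = (n : ℝ)⁻¹ *
      ∑ k, (inner ℂ (partialDeriv i ψ θ) (e k)).re * (inner ℂ (partialDeriv j ψ θ) (e k)).re := by
  have hn' : (n : ℝ)⁻¹ ≠ 0 := inv_ne_zero (Nat.cast_ne_zero.2 hn)
  have hlog : ∀ k i, partialDeriv i (fun η =>
      Real.log (outcomeProb (tiltMeasurement hn (hψ θ) he hsum) ψ k η)) θ =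
        (inner ℂ (partialDeriv i ψ θ) (e k)).re := fun k i => by
    simp only [outcomeProb_tiltMeasurement]
    exact partialDeriv_log_tilt hψ hd hn' (heψ k) i
  simp only [fisher, Matrix.of_apply, hlog]
  simp only [outcomeProb_tiltMeasurement, heψ, hψ, Finset.mul_sum, one_pow, mul_zero,
    Complex.zero_re, add_zero, mul_one, mul_assoc]

variable [FiniteDimensional ℂ H]

lemma exists_fisher_eq_smul_qfim (hψ : ∀ η, ‖ψ η‖ = 1) (hd : DifferentiableAt ℝ ψ θ) :
    ∃ (n : ℕ) (E : Measurement H n),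
      fisher E ψ θ = (4 * Module.finrank ℝ H : ℝ)⁻¹ • qfim ψ θ := by
  have : Nontrivial H := nontrivial_of_ne _ _ (norm_ne_zero_iff.1 ((hψ θ).trans_ne one_ne_zero))
  have : FiniteDimensional ℝ H := FiniteDimensional.complexToReal H
  obtain ⟨b, hb, hparseval⟩ := exists_norm_eq_one_sum_re_inner_mul_re_inner H
  let P : H →L[ℂ] H := (ℂ ∙ ψ θ)ᗮ.starProjection
  let e : Fin (Module.finrank ℝ H + Module.finrank ℝ H) → H :=
    Fin.append (fun a => P (b a)) (fun a => -P (b a))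
  have hPb : ∀ a, ‖P (b a)‖ ≤ 1 := fun a =>
    (Submodule.norm_starProjection_apply_le _ _).trans (hb a).le
  have hPψ : ∀ x, inner ℂ (P x) (ψ θ) = 0 := fun x =>
    Submodule.mem_orthogonal_singleton_iff_inner_left.1 (Submodule.starProjection_apply_mem _ x)
  have he : ∀ k, ‖e k‖ ≤ 1 := Fin.addCases (by simpa only [e, Fin.append_left] using hPb)
    (by simpa only [e, Fin.append_right, norm_neg] using hPb)
  have heψ : ∀ k, inner ℂ (e k) (ψ θ) = 0 := Fin.addCases
    (by simpa only [e, Fin.append_left] using fun a => hPψ (b a))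
    (by simpa only [e, Fin.append_right, inner_neg_left, neg_eq_zero] using fun a => hPψ (b a))
  have hsum : ∑ k, e k = 0 := by
    simp only [e, Fin.sum_univ_add, Fin.append_left, Fin.append_right, Finset.sum_neg_distrib,
      add_neg_cancel]
  have hn : Module.finrank ℝ H + Module.finrank ℝ H ≠ 0 :=
    (add_pos Module.finrank_pos Module.finrank_pos).ne'
  have hhoriz : ∀ i a, inner ℂ (partialDeriv i ψ θ) (P (b a)) = inner ℂ (horizDeriv i ψ θ) (b a) :=
    fun i a => (Submodule.inner_starProjection_left_eq_right _ _ _).symm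
  refine ⟨_, tiltMeasurement hn (hψ θ) he hsum, ?_⟩
  ext i j
  rw [fisher_tiltMeasurement hψ hd hn he hsum heψ, Matrix.smul_apply, smul_eq_mul,
    qfim_eq_re_inner_horizDeriv (hψ θ), ← hparseval]
  simp only [e, Fin.sum_univ_add, Fin.append_left, Fin.append_right, inner_neg_right,
    Complex.neg_re, neg_mul_neg, hhoriz]
  push_cast
  field_simp

lemma riskMI_le_scalarRisk (hψ : ∀ η, ‖ψ η‖ = 1) (hd : DifferentiableAt ℝ ψ θ) (N : ℕ)
    (W : Matrix (Fin M) (Fin M) ℝ) :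
    riskMI N ψ θ W ≤ scalarRisk N ((4 * Module.finrank ℝ H : ℝ)⁻¹ • qfim ψ θ) W := by
  obtain ⟨n, E, hE⟩ := exists_fisher_eq_smul_qfim hψ hd
  rw [← hE]
  exact iInf₂_le n E

end Fisher

/-! ### Limits of amplified matrices -/

section Matrix

variable {ι : Type*} {l : Filter ι} {p : ι → ℝ}

lemma tendsto_atTop_of_tendsto_mul {a : ι → ℝ} {b : ℝ} (hp : Tendsto p l (𝓝[>] 0))
    (hpa : Tendsto (fun n => p n * a n) l (𝓝 b)) (hb : 0 < b) : Tendsto a l atTop := by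
  refine (hp.inv_tendsto_nhdsGT_zero.atTop_mul_pos hb hpa).congr' ?_
  filter_upwards [hp self_mem_nhdsWithin] with n hn
  exact inv_mul_cancel_left₀ (ne_of_gt hn) _

variable {n : Type*} {Q : ι → Matrix n n ℝ} {Q₀ : Matrix n n ℝ}

lemma tendsto_abs_apply_atTop (hp : Tendsto p l (𝓝[>] 0))
    (hQ : Tendsto (fun k => p k • Q k) l (𝓝 Q₀)) {i j : n} (hij : Q₀ i j ≠ 0) :
    Tendsto (fun k => |Q k i j|) l atTop := by
  have hentry : Tendsto (fun k => |p k * Q k i j|) l (𝓝 |Q₀ i j|) :=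
    (tendsto_pi_nhds.1 (tendsto_pi_nhds.1 hQ i) j).abs
  refine tendsto_atTop_of_tendsto_mul hp (hentry.congr' ?_) (abs_pos.2 hij)
  filter_upwards [hp self_mem_nhdsWithin] with k hk
  rw [abs_mul, abs_of_pos hk]

lemma eventually_posDef [Finite n] (hQ₀ : Q₀.PosDef) : ∀ᶠ S in 𝓝 Q₀, S.IsHermitian → S.PosDef := by
  have := Fintype.ofFinite n
  have hcont : Continuous fun z : Matrix n n ℝ × (n → ℝ) => star z.2 ⬝ᵥ z.1.mulVec z.2 := by
    fun_prop
  have hsphere : ∀ᶠ S in 𝓝 Q₀, ∀ x ∈ Metric.sphere (0 : n → ℝ) 1, 0 < star x ⬝ᵥ S.mulVec x :=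
    (isCompact_sphere 0 1).eventually_forall_of_forall_eventually fun x hx =>
      (hcont.tendsto (Q₀, x)).eventually_const_lt
        (hQ₀.dotProduct_mulVec_pos (Metric.ne_of_mem_sphere hx one_ne_zero))
  filter_upwards [hsphere] with S hS hSH
  refine .of_dotProduct_mulVec_pos hSH fun x hx => ?_
  have hx₀ : 0 < ‖x‖ := norm_pos_iff.2 hx
  have hunit := hS (‖x‖⁻¹ • x) (by
    rw [mem_sphere_zero_iff_norm, norm_smul, norm_inv, norm_norm, inv_mul_cancel₀ hx₀.ne'])
  rw [star_smul, Matrix.mulVec_smul, dotProduct_smul, smul_dotProduct, star_trivial] at hunit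
  exact pos_of_smul_pos_left (pos_of_smul_pos_left hunit (by positivity)) (by positivity)

variable [DecidableEq n]

lemma eventually_posSemidef_sub_smul_one [Finite n] (hp : Tendsto p l (𝓝[>] 0))
    (hQ : Tendsto (fun k => p k • Q k) l (𝓝 Q₀)) (hQ₀ : Q₀.PosDef)
    (hQH : ∀ᶠ k in l, (Q k).IsHermitian) (B : ℝ) :
    ∀ᶠ k in l, (Q k - B • (1 : Matrix n n ℝ)).PosSemidef := by
  have hlim : Tendsto (fun k => p k • (Q k - B • (1 : Matrix n n ℝ))) l (𝓝 Q₀) := by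
    simpa only [smul_sub, zero_smul, sub_zero] using
      hQ.sub ((tendsto_nhds_of_tendsto_nhdsWithin hp).smul_const (B • (1 : Matrix n n ℝ)))
  filter_upwards [hlim.eventually (eventually_posDef hQ₀), hQH, hp self_mem_nhdsWithin]
    with k hk hH hpk
  have hherm : (Q k - B • (1 : Matrix n n ℝ)).IsHermitian :=
    hH.sub (Matrix.isHermitian_one.smul (IsSelfAdjoint.all B))
  have hinv : (0 : ℝ) ≤ (p k)⁻¹ := inv_nonneg.2 (le_of_lt hpk)
  have hpos := (hk (hherm.smul (IsSelfAdjoint.all (p k)))).posSemidef.smul hinv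
  rwa [inv_smul_smul₀ (ne_of_gt hpk)] at hpos

lemma tendsto_det_atTop [Fintype n] [Nonempty n] (hp : Tendsto p l (𝓝[>] 0))
    (hQ : Tendsto (fun k => p k • Q k) l (𝓝 Q₀)) (hQ₀ : 0 < Q₀.det) :
    Tendsto (fun k => (Q k).det) l atTop := by
  have hpow : Tendsto (fun k => p k ^ Fintype.card n) l (𝓝[>] 0) := by
    refine tendsto_nhdsWithin_iff.2
      ⟨?_, (hp.eventually self_mem_nhdsWithin).mono fun k hk => pow_pos hk _⟩
    simpa using (tendsto_nhds_of_tendsto_nhdsWithin hp).pow (Fintype.card n)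
  refine tendsto_atTop_of_tendsto_mul hpow ?_ hQ₀
  simpa only [Function.comp_def, id, Matrix.det_smul] using
    (continuous_id.matrix_det.tendsto Q₀).comp hQ

end Matrix

lemma tendsto_scalarRisk_zero {ι : Type*} {l : Filter ι} {p : ι → ℝ}
    {Q : ι → Matrix (Fin M) (Fin M) ℝ} {Q₀ : Matrix (Fin M) (Fin M) ℝ}
    (hp : Tendsto p l (𝓝[>] 0)) (hQ : Tendsto (fun k => p k • Q k) l (𝓝 Q₀)) (hQ₀ : Q₀.det ≠ 0)
    (N : ℕ) (W : Matrix (Fin M) (Fin M) ℝ) :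
    Tendsto (fun k => scalarRisk N (Q k) W) l (𝓝 0) := by
  have hdet : Tendsto (fun k => (p k • Q k).det) l (𝓝 Q₀.det) :=
    (continuous_id.matrix_det.tendsto Q₀).comp hQ
  have hinv : Tendsto (fun k => (p k • Q k)⁻¹) l (𝓝 Q₀⁻¹) := by
    simp only [Matrix.inv_def, Ring.inverse_eq_inv']
    exact (hdet.inv₀ hQ₀).smul ((continuous_id.matrix_adjugate.tendsto Q₀).comp hQ)
  have htrace : Tendsto (fun k => (W * (p k • Q k)⁻¹).trace) l (𝓝 (W * Q₀⁻¹).trace) :=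
    ((continuous_const.matrix_mul continuous_id).matrix_trace.tendsto Q₀⁻¹).comp hinv
  have hlim : Tendsto (fun k => ENNReal.ofReal (p k * (W * (p k • Q k)⁻¹).trace / N)) l (𝓝 0) := by
    simpa only [zero_mul, zero_div, ENNReal.ofReal_zero] using ENNReal.tendsto_ofReal
      (((tendsto_nhds_of_tendsto_nhdsWithin hp).mul htrace).div_const (N : ℝ))
  refine hlim.congr' ?_
  filter_upwards [hp self_mem_nhdsWithin, hdet.eventually_ne hQ₀] with k hk hdetk
  have hpk : p k ≠ 0 := ne_of_gt hk
  have hQk : (Q k).det ≠ 0 := right_ne_zero_of_mul (Matrix.det_smul (Q k) (p k) ▸ hdetk)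
  have : Invertible (p k) := invertibleOfNonzero hpk
  rw [scalarRisk, if_neg hQk, Matrix.inv_smul _ _ hQk.isUnit, invOf_eq_inv, Matrix.mul_smul,
    Matrix.trace_smul, smul_eq_mul, mul_inv_cancel_left₀ hpk]

lemma tendsto_riskMI_zero [FiniteDimensional ℂ H] {ι : Type*} {l : Filter ι} {p : ι → ℝ}
    {ψ : ι → (Fin M → ℝ) → H} {θ : Fin M → ℝ} {Q₀ : Matrix (Fin M) (Fin M) ℝ}
    (hψ : ∀ᶠ k in l, (∀ η, ‖ψ k η‖ = 1) ∧ DifferentiableAt ℝ (ψ k) θ)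
    (hp : Tendsto p l (𝓝[>] 0)) (hQ : Tendsto (fun k => p k • qfim (ψ k) θ) l (𝓝 Q₀))
    (hQ₀ : Q₀.det ≠ 0) (N : ℕ) (W : Matrix (Fin M) (Fin M) ℝ) :
    Tendsto (fun k => riskMI N (ψ k) θ W) l (𝓝 0) := by
  rcases l.eq_or_neBot with rfl | hl
  · exact tendsto_bot
  obtain ⟨k, hk, -⟩ := hψ.exists
  have : Nontrivial H := nontrivial_of_ne _ _ (norm_ne_zero_iff.1 ((hk θ).trans_ne one_ne_zero))
  have : FiniteDimensional ℝ H := FiniteDimensional.complexToReal H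
  have hc : (4 * Module.finrank ℝ H : ℝ)⁻¹ ≠ 0 := by
    have := Module.finrank_pos (R := ℝ) (M := H)
    positivity
  have hcQ : Tendsto (fun k => p k • (4 * Module.finrank ℝ H : ℝ)⁻¹ • qfim (ψ k) θ) l
      (𝓝 ((4 * Module.finrank ℝ H : ℝ)⁻¹ • Q₀)) := by
    simpa only [smul_comm _ (_ : ℝ)⁻¹] using hQ.const_smul (4 * Module.finrank ℝ H : ℝ)⁻¹
  have hdet : ((4 * Module.finrank ℝ H : ℝ)⁻¹ • Q₀).det ≠ 0 := by
    rw [Matrix.det_smul]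
    exact mul_ne_zero (pow_ne_zero _ hc) hQ₀
  exact tendsto_of_tendsto_of_tendsto_of_le_of_le' tendsto_const_nhds
    (tendsto_scalarRisk_zero hp hcQ hdet N W) (.of_forall fun _ => zero_le)
    (hψ.mono fun k hk => riskMI_le_scalarRisk hk.1 hk.2 N W)

end QLearn

theorem theorem2 {H : Type*} [NormedAddCommGroup H] [InnerProductSpace ℂ H] [CompleteSpace H]
    [FiniteDimensional ℂ H] (M : ℕ) (hM : 1 ≤ M)
    (A : Fin M → H →L[ℂ] H) (hA : ∀ m, IsSelfAdjoint (A m))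
    (ψ₀ : H) (hψ₀ : ‖ψ₀‖ = 1) (θ : Fin M → ℝ) :
    -- for all `0 ≤ t ≤ 1` the pair `{F, 1 - F}` with `F = K†K` is a measurement
    (∀ (θ₀ : Fin M → ℝ) (t : ℝ), t ∈ Set.Icc (0 : ℝ) 1 →
      (QLearn.postF (QLearn.distK A ψ₀ θ₀ t)).IsPositive ∧
      (1 - QLearn.postF (QLearn.distK A ψ₀ θ₀ t)).IsPositive) ∧
    -- success probability, postselected QFIM and losslessness, up to errors of order `δ²`
    (∃ C : ℝ, ∀ θ₀ : Fin M → ℝ,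
      (∀ t ∈ Set.Icc (0 : ℝ) 1,
        |QLearn.distProb A ψ₀ θ₀ t θ - t ^ 2| ≤ C * ‖θ - θ₀‖ ^ 2) ∧
      ∀ t ∈ Set.Ioc (0 : ℝ) 1,
        0 < QLearn.distProb A ψ₀ θ₀ t θ ∧
        ∀ i j : Fin M,
          |QLearn.qfim (QLearn.distState A ψ₀ θ₀ t) θ i j
              - QLearn.qfim (QLearn.encState A ψ₀) θ i j / t ^ 2|
            ≤ C * ‖θ - θ₀‖ ^ 2 / t ^ 4 ∧
          |QLearn.distProb A ψ₀ θ₀ t θ * QLearn.qfim (QLearn.distState A ψ₀ θ₀ t) θ i j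
              - QLearn.qfim (QLearn.encState A ψ₀) θ i j|
            ≤ C * ‖θ - θ₀‖ ^ 2 / t ^ 2) ∧
    -- the limit `M δ² ≪ t² → 0`
    (∀ (t : ℕ → ℝ) (θ₀ : ℕ → Fin M → ℝ), Tendsto t atTop (𝓝[>] 0) →
      Tendsto (fun n => (M : ℝ) * ‖θ - θ₀ n‖ ^ 2 / t n ^ 2) atTop (𝓝 0) →
      -- the distillation is lossless in the limit
      Tendsto (fun n => QLearn.distProb A ψ₀ (θ₀ n) (t n) θ
          • QLearn.qfim (QLearn.distState A ψ₀ (θ₀ n) (t n)) θ) atTop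
        (𝓝 (QLearn.qfim (QLearn.encState A ψ₀) θ)) ∧
      -- every nonzero entry of the QFIM is amplified without bound
      (∀ i j : Fin M, QLearn.qfim (QLearn.encState A ψ₀) θ i j ≠ 0 →
        Tendsto (fun n => |QLearn.qfim (QLearn.distState A ψ₀ (θ₀ n) (t n)) θ i j|)
          atTop atTop) ∧
      -- for a nonsingular QFIM the whole matrix diverges and the optimal risk vanishes
      ((QLearn.qfim (QLearn.encState A ψ₀) θ).det ≠ 0 →
        (∀ B : ℝ, ∀ᶠ n in atTop,
          (QLearn.qfim (QLearn.distState A ψ₀ (θ₀ n) (t n)) θ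
            - B • (1 : Matrix (Fin M) (Fin M) ℝ)).PosSemidef) ∧
        Tendsto (fun n => (QLearn.qfim (QLearn.distState A ψ₀ (θ₀ n) (t n)) θ).det)
          atTop atTop ∧
        ∀ (N : ℕ), 1 ≤ N → ∀ W : Matrix (Fin M) (Fin M) ℝ, W.PosSemidef →
          Tendsto (fun n => QLearn.riskMI N (QLearn.distState A ψ₀ (θ₀ n) (t n)) θ W)
            atTop (𝓝 0))) := by
  have hψ : ∀ η, ‖QLearn.encState A ψ₀ η‖ = 1 := fun η => (QLearn.norm_encState hA ψ₀ η).trans hψ₀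
  have hd : DifferentiableAt ℝ (QLearn.encState A ψ₀) θ := QLearn.differentiable_encState A ψ₀ θ
  have hM₀ : (M : ℝ) ≠ 0 := Nat.cast_ne_zero.2 (Nat.one_le_iff_ne_zero.1 hM)
  have : Nonempty (Fin M) := ⟨⟨0, hM⟩⟩
  simp only [QLearn.distK_eq_distillOp, QLearn.distProb_eq_norm_sq,
    QLearn.distState_eq_postselected]
  refine ⟨fun θ₀ t ht => ⟨QLearn.isPositive_postF _,
    QLearn.isPositive_one_sub_postF_distillOp (hψ θ₀) ht⟩,
    QLearn.exists_distillation_bounds hψ hd, fun t θ₀ ht hMδ => ?_⟩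
  have hδ : Tendsto (fun n => ‖θ - θ₀ n‖ ^ 2 / t n ^ 2) atTop (𝓝 0) := by
    simpa only [mul_div_assoc, inv_mul_cancel_left₀ hM₀, mul_zero] using hMδ.const_mul (M : ℝ)⁻¹
  have hp := QLearn.tendsto_norm_distillOp_sq hψ hd ht hδ
  have hQ := QLearn.tendsto_smul_qfim_postselected hψ hd ht hδ
  have hps := QLearn.eventually_postselected_normalized_differentiable hψ hd ht θ₀
  refine ⟨hQ, fun i j hij => QLearn.tendsto_abs_apply_atTop hp hQ hij, fun hdet => ?_⟩
  have hpos : (QLearn.qfim (QLearn.encState A ψ₀) θ).PosDef :=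
    (QLearn.posSemidef_qfim (hψ θ)).posDef_iff_det_ne_zero.2 hdet
  exact ⟨QLearn.eventually_posSemidef_sub_smul_one hp hQ hpos
      (hps.mono fun n hn => (QLearn.posSemidef_qfim (hn.1 θ)).isHermitian),
    QLearn.tendsto_det_atTop hp hQ hpos.det_pos,
    fun N _ W _ => QLearn.tendsto_riskMI_zero hps hp hQ hdet N W⟩
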